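/- Let $(W,S)$ be a Coxeter system with $S$ finite and $W$ infinite, and let $|\cdot|$ be the word length on $W$ with respect to $S$. Let $\mathbb{R}_{>0}^{(W,S)}$, $\mathbb{C}^{(W,S)}$ and $\{-1,1\}^{(W,S)}$ denote the sets of families $(z_s)_{s\in S}$ of positive real numbers, of complex numbers, and of signs, respectively, such that $z_s=z_t$ whenever $s$ and $t$ are conjugate in $W$. For $z\in\mathbb{C}^{(W,S)}$ and $w\in W$ put $z_w:=z_{s_1}\cdots z_{s_n}$, where $w=s_1\cdots s_n$ is a reduced expression (the value does not depend on its choice). Let $\mathcal{R}\subseteq\mathbb{C}^{(W,S)}$ be the region of convergence of the growth series $\sum_{w\in W}z_w$, that is, the set of all $z$ for which the series converges (unconditionally), and let $$\mathcal{R}':=\left\{(q_s^{\epsilon_s})_{s\in S}\;\middle|\; q\in\mathcal{R}\cap\mathbb{R}_{>0}^{(W,S)},\ \epsilon\in\{-1,1\}^{(W,S)}\right\}.$$ Let $q\in\mathbb{R}_{>0}^{(W,S)}$, put $p_s(q):=q_s^{-1/2}(q_s-1)$, and for $s\in S$ let $T_s^{(q)}$ be the bounded operator on $\ell^2(W)$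 (with canonical orthonormal basis $(\delta_w)_{w\in W}$) given by $T_s^{(q)}\delta_w=\delta_{sw}$ if $|sw|>|w|$ and $T_s^{(q)}\delta_w=\delta_{sw}+p_s(q)\delta_w$ if $|sw|<|w|$. Let $\mathbb{C}_q[W]$ be the unital $*$-algebra of operators generated by the $T_s^{(q)}$, $s\in S$, let $C^*_{r,q}(W)$ be its norm closure, let $\mathcal{N}_q(W):=(C^*_{r,q}(W))''\subseteq\mathcal{B}(\ell^2(W))$ be the Hecke--von Neumann algebra, and let $\mathcal{K}$ be the space of compact operators on $\ell^2(W)$. Then $$\mathcal{N}_q(W)\cap\mathcal{K}\neq 0\quad\Longleftrightarrow\quad q\in\mathcal{R}'.$$ -/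

import Mathlib

open scoped ENNReal

noncomputable section

namespace CoxeterHecke

/-! ### Class-invariant parameters and the growth series -/

section Parameters

variable {B W : Type*} [Group W] {M : CoxeterMatrix B} (cs : CoxeterSystem M W)

/-- A family `z = (z_s)` indexed by the simple reflections is class-invariant if `z_s = z_t`
whenever `s` and `t` are conjugate in `W`. -/
def IsClassInvariant {R : Type*} (z : B → R) : Prop :=
  ∀ i j : B, IsConj (cs.simple i) (cs.simple j) → z i = z j

/-- `ℝ_{>0}^{(W,S)}`: the class-invariant families of positive real numbers. -/
def PosParam : Set (B → ℝ) :=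
  {q | (∀ i, 0 < q i) ∧ IsClassInvariant cs q}

/-- `ℂ^{(W,S)}`: the class-invariant families of complex numbers. -/
def ComplexParam : Set (B → ℂ) :=
  {z | IsClassInvariant cs z}

/-- `{-1, 1}^{(W,S)}`: the class-invariant families of signs. -/
def SignParam : Set (B → ℤˣ) :=
  {ε | IsClassInvariant cs ε}

/-- A reduced expression of `w`. -/
def reducedWord (w : W) : List B := (cs.exists_isReduced w).choose

theorem isReduced_reducedWord (w : W) : cs.IsReduced (reducedWord cs w) :=
  (cs.exists_isReduced w).choose_spec.1

theorem wordProd_reducedWord (w : W) : cs.wordProd (reducedWord cs w) = w :=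
  (cs.exists_isReduced w).choose_spec.2.symm

/-- The monomial `z_w = z_{s₁} ⋯ z_{sₙ}`, where `w = s₁ ⋯ sₙ` is a reduced expression. For
class-invariant `z` (the only case used) the value is the same for all reduced expressions. -/
def monomial (z : B → ℂ) (w : W) : ℂ := ((reducedWord cs w).map z).prod

/-- The region of convergence `𝓡` of the growth series `W(z) = ∑_{w ∈ W} z_w`. -/
def convergenceRegion : Set (B → ℂ) :=
  {z | z ∈ ComplexParam cs ∧ Summable fun w : W => monomial cs z w}

/-- The set `𝓡'` of all `(q_s ^ ε_s)_s` with `q ∈ 𝓡 ∩ ℝ_{>0}^{(W,S)}`, `ε ∈ {-1, 1}^{(W,S)}`. -/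
def convergenceRegion' : Set (B → ℝ) :=
  {q' | ∃ q ∈ PosParam cs, (fun i => (q i : ℂ)) ∈ convergenceRegion cs ∧
    ∃ ε ∈ SignParam cs, q' = fun i => q i ^ ((ε i : ℤˣ) : ℤ)}

end Parameters

/-! ### Operators on `ℓ²(W)` -/

/-- The Hilbert space `ℓ²(X)` of square-summable complex functions on `X`. -/
abbrev ell2 (X : Type*) : Type _ := lp (fun _ : X => ℂ) 2

section Operators

variable {X : Type*}

theorem memℓp_comp (e : X ≃ X) (f : ell2 X) :
    Memℓp (E := fun _ : X => ℂ) (fun x => f (e x)) 2 :=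
  memℓp_gen (((lp.memℓp f).summable (by norm_num)).comp_injective e.injective)

/-- The composition operator `f ↦ f ∘ e` on `ℓ²(X)`, for a permutation `e` of `X`. -/
def compOp (e : X ≃ X) : ell2 X →L[ℂ] ell2 X :=
  LinearMap.mkContinuous
    { toFun := fun f => ⟨fun x => f (e x), memℓp_comp e f⟩
      map_add' := fun _ _ => rfl
      map_smul' := fun _ _ => rfl } 1 (fun f => by
    rw [one_mul]
    refine lp.norm_le_of_tsum_le (by norm_num) (norm_nonneg f) ?_
    rw [lp.norm_rpow_eq_tsum (by norm_num) f]
    exact (e.tsum_eq (fun x => ‖f x‖ ^ (2 : ℝ≥0∞).toReal)).le)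

@[simp] theorem compOp_apply (e : X ≃ X) (f : ell2 X) (x : X) : compOp e f x = f (e x) := rfl

theorem norm_indicator_le' (A : Set X) (f : X → ℂ) (x : X) : ‖A.indicator f x‖ ≤ ‖f x‖ :=
  norm_indicator_le_norm_self f x

/-- The orthogonal projection of `ℓ²(X)` onto the functions supported in `A`. -/
def restrictOp (A : Set X) : ell2 X →L[ℂ] ell2 X :=
  LinearMap.mkContinuous
    { toFun := fun f => ⟨A.indicator f, (lp.memℓp f).mono' (norm_indicator_le' A f)⟩
      map_add' := fun f g => lp.ext (Set.indicator_add A f g)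
      map_smul' := fun c f => lp.ext (Set.indicator_const_smul A c f) } 1 (fun f => by
    rw [one_mul]
    exact lp.norm_mono (by norm_num) (norm_indicator_le' A f))

@[simp] theorem restrictOp_apply (A : Set X) (f : ell2 X) (x : X) :
    restrictOp A f x = A.indicator f x := rfl

end Operators

/-! ### Hecke operator algebras -/

section Hecke

variable {B W : Type*} [Group W] {M : CoxeterMatrix B} (cs : CoxeterSystem M W)

/-- `p_s(q) = q_s^{-1/2} (q_s - 1)`. -/
def pCoeff (q : B → ℝ) (i : B) : ℝ := q i ^ (-(1 / 2) : ℝ) * (q i - 1)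

/-- The operator `T_s^{(q)}` on `ℓ²(W)`: the sum of the left translation by `s` and of `p_s(q)`
times the projection onto the functions supported on `{w | |s w| < |w|}`. -/
def heckeOp (q : B → ℝ) (i : B) : ell2 W →L[ℂ] ell2 W :=
  compOp (Equiv.mulLeft (cs.simple i)) +
    (pCoeff q i : ℂ) • restrictOp {w : W | cs.IsLeftDescent w i}

open Classical in
/-- The defining formula: `T_s δ_w = δ_{sw}` if `|sw| > |w|`, and
`T_s δ_w = δ_{sw} + p_s(q) δ_w` if `|sw| < |w|`. -/
theorem heckeOp_single (q : B → ℝ) (i : B) (w : W) :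
    heckeOp cs q i (lp.single 2 w 1) =
      if cs.length w < cs.length (cs.simple i * w) then lp.single 2 (cs.simple i * w) (1 : ℂ)
      else lp.single 2 (cs.simple i * w) (1 : ℂ) + (pCoeff q i : ℂ) • lp.single 2 w (1 : ℂ) := by
  have key : compOp (Equiv.mulLeft (cs.simple i)) (lp.single 2 w (1 : ℂ)) =
      lp.single 2 (cs.simple i * w) (1 : ℂ) := by
    refine lp.ext (funext fun v => ?_)
    have hiff : cs.simple i * v = w ↔ v = cs.simple i * w := by
      constructor
      · rintro rfl; simp
      · rintro rfl; simp
    simp [lp.single_apply, Pi.single_apply, hiff]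
  have key2 : restrictOp {w : W | cs.IsLeftDescent w i} (lp.single 2 w (1 : ℂ)) =
      if cs.IsLeftDescent w i then lp.single 2 w (1 : ℂ) else 0 := by
    refine lp.ext (funext fun v => ?_)
    by_cases hv : v = w
    · subst hv
      by_cases h : cs.IsLeftDescent v i <;> simp [h, Set.indicator]
    · by_cases h : cs.IsLeftDescent w i <;>
        simp [h, Set.indicator, lp.single_apply, hv]
  have hd : cs.length w < cs.length (cs.simple i * w) ↔ ¬ cs.IsLeftDescent w i := by
    have := cs.length_simple_mul_ne w i
    unfold CoxeterSystem.IsLeftDescent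
    omega
  have hsum : heckeOp cs q i (lp.single 2 w 1) =
      compOp (Equiv.mulLeft (cs.simple i)) (lp.single 2 w (1 : ℂ)) +
        (pCoeff q i : ℂ) • restrictOp {w : W | cs.IsLeftDescent w i} (lp.single 2 w (1 : ℂ)) := rfl
  rw [hsum, key, key2]
  by_cases h : cs.IsLeftDescent w i
  · rw [if_pos h, if_neg (by rw [hd]; exact not_not.mpr h)]
  · rw [if_neg h, if_pos (hd.mpr h), smul_zero, add_zero]

/-- The Hecke algebra `ℂ_q[W]`, acting on `ℓ²(W)`: the unital `*`-algebra of operators generated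
by the `T_s^{(q)}`. -/
def heckeAlgebra (q : B → ℝ) : StarSubalgebra ℂ (ell2 W →L[ℂ] ell2 W) :=
  StarAlgebra.adjoin ℂ (Set.range (heckeOp cs q))

/-- The reduced Hecke C*-algebra `C*_{r,q}(W)`: the norm closure of `ℂ_q[W]`. -/
def heckeCStarAlgebra (q : B → ℝ) : StarSubalgebra ℂ (ell2 W →L[ℂ] ell2 W) :=
  (heckeAlgebra cs q).topologicalClosure

/-- The Hecke-von Neumann algebra `𝓝_q(W)`: the bicommutant of `C*_{r,q}(W)` in `𝓑(ℓ²(W))`. -/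
def heckeVonNeumannAlgebra (q : B → ℝ) : VonNeumannAlgebra (ell2 W) where
  toStarSubalgebra := StarSubalgebra.centralizer ℂ
    (StarSubalgebra.centralizer ℂ (heckeCStarAlgebra cs q : Set (ell2 W →L[ℂ] ell2 W)) :
      Set (ell2 W →L[ℂ] ell2 W))
  centralizer_centralizer' := by
    simp

/-- The underlying set of `𝓝_q(W)` is the algebraic bicommutant of `C*_{r,q}(W)`. -/
theorem coe_heckeVonNeumannAlgebra (q : B → ℝ) :
    (heckeVonNeumannAlgebra cs q : Set (ell2 W →L[ℂ] ell2 W)) =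
      Set.centralizer (Set.centralizer
        (heckeCStarAlgebra cs q : Set (ell2 W →L[ℂ] ell2 W))) := by
  have h := StarSubalgebra.coe_centralizer_centralizer ℂ
    (heckeCStarAlgebra cs q : Set (ell2 W →L[ℂ] ell2 W))
  rw [StarMemClass.star_coe_eq, Set.union_self] at h
  exact h

end Hecke

end CoxeterHecke

end

/-!
The proof rests on two observations about the operators `T_s` and their right-handed counterparts
`R_s`, which commute with all `T_s` (`commute_heckeOp_rightHeckeOp`).

*Convergence gives a compact operator.* The Hecke algebra has the characters sending `T_s` to
`q_s ^ (1/2)` or to `-q_s ^ (-1/2)`, the choice being made on each conjugacy class. The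
function `ξ(w) = c_w` with these values `c_s` satisfies `T_s ξ = c_s ξ`, and it lies
in `ℓ²(W)` exactly if the growth series converges at `(c_s²) = (q_s ^ (±1))`. Since a joint
eigenvector is determined by its value at `1` (`eq_smul_of_heckeOp_eigen`), the joint eigenspace is
a line. The commutant preserves this line, so the rank one operator of `ξ` lies in the bicommutant
(`rankOne_mem_heckeVonNeumannAlgebra`).

*A compact operator gives convergence.* If `x ≠ 0` is compact and in the von Neumann algebra, some
eigenspace `V` of `x* x` is nonzero and finite-dimensional, and it is invariant under the commutant,
hence under all `R_s`. Let `P` be the projection onto `V`. For a reduced expression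
`w = s₁ ⋯ sₙ` one has `P δ_w = R_{sₙ} ⋯ R_{s₁} P δ_1`, and `R_s` is self-adjoint with eigenvalues
`q_s ^ (1/2)` and `-q_s ^ (-1/2)`, so `‖P δ_w‖² ≥ m_w ‖P δ_1‖²` with `m_s = min (q_s, q_s⁻¹)`
(`prod_min_mul_norm_sq_le`). The left-hand side is summable over `w`, its sum being `dim V`, and
`P δ_1 ≠ 0` because `V ≠ 0`. Thus the growth series converges at `m`, and `q` arises from `m` by
inverting the coordinates with `q_s > 1`.

The facts on Coxeter groups that enter, namely the independence of `c_w` of the reduced expression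
and the behaviour of descent sets under multiplication by a generator, are deduced from the
reflection cocycle `inversionParity` and the strong exchange property that it yields.
-/

noncomputable section

/-! ### The reflection cocycle and the strong exchange property -/

namespace CoxeterSystem

variable {B W : Type*} [Group W] {M : CoxeterMatrix B} (cs : CoxeterSystem M W)

open List

theorem _root_.Function.End.mul_apply' {X : Type*} (f g : Function.End X) (x : X) :
    (f * g) x = f (g x) := rfl

open Classical in
/-- The action of the `i`-th generator in the sign-twisted conjugation action on `W × ℤ/2`:
conjugation by `s_i` on the first coordinate, and a change of sign precisely over `s_i`. The first
coordinate runs over all of `W`, not only over the reflections. -/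
def signedConj (i : B) : Function.End (W × ZMod 2) := fun x =>
  (cs.simple i * x.1 * cs.simple i, x.2 + if x.1 = cs.simple i then 1 else 0)

open Classical in
theorem prod_map_signedConj_apply (ω : List B) (t : W) (e : ZMod 2) :
    (ω.map cs.signedConj).prod (t, e) =
      (cs.wordProd ω * t * (cs.wordProd ω)⁻¹, e + ((cs.rightInvSeq ω).count t : ZMod 2)) := by
  induction ω with
  | nil => simp [Function.End.one_def]
  | cons i ω ih =>
    rw [map_cons, prod_cons, Function.End.mul_apply', ih, signedConj,
      rightInvSeq, count_cons, wordProd_cons]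
    have h : (cs.wordProd ω * t * (cs.wordProd ω)⁻¹ = cs.simple i) ↔
        ((cs.wordProd ω)⁻¹ * cs.simple i * cs.wordProd ω = t) := by
      constructor
      · intro h; rw [← h]; group
      · rintro rfl; group
    ext
    · simp [mul_assoc]
    · by_cases h' : (cs.wordProd ω)⁻¹ * cs.simple i * cs.wordProd ω = t
      · simp [h, h', add_assoc]
      · simp [h, h']

theorem map_alternatingWord_prod {G : Type*} [Monoid G] (f : B → G) (i j : B) (m : ℕ) :
    ((alternatingWord i j (2 * m)).map f).prod = (f i * f j) ^ m := by
  induction m with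
  | zero => simp [alternatingWord]
  | succ m ih =>
    rw [show 2 * (m + 1) = 2 * m + 1 + 1 by ring, alternatingWord_succ', alternatingWord_succ',
      pow_succ', ← ih]
    simp [mul_assoc]

theorem alternatingWord_reverse (i j : B) (m : ℕ) :
    (alternatingWord i j (2 * m)).reverse = alternatingWord j i (2 * m) := by
  induction m with
  | zero => simp [alternatingWord]
  | succ m ih =>
    rw [show 2 * (m + 1) = 2 * m + 1 + 1 by ring, alternatingWord_succ', alternatingWord_succ',
      alternatingWord_succ, alternatingWord_succ]
    simp [ih]

open Classical in
/-- The inversion sequence of the word `(s_i s_j)^{m_{ij}}` has period `m_{ij}`, so every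
element occurs in it an even number of times. -/
theorem even_count_rightInvSeq_alternatingWord (i j : B) (t : W) :
    Even ((cs.rightInvSeq (alternatingWord i j (2 * M i j))).count t) := by
  rw [← alternatingWord_reverse, rightInvSeq_reverse, count_reverse]
  set l := cs.leftInvSeq (alternatingWord j i (2 * M i j)) with hl
  have hlen : l.length = 2 * M i j := by simp [hl]
  have hper : l.take (M i j) = l.drop (M i j) := by
    refine List.ext_getElem (by simp [hlen]; omega) fun k h₁ h₂ => ?_
    have hk : k < M i j := by
      simp only [length_take, hlen] at h₁; omega
    rw [getElem_take, getElem_drop]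
    simp only [hl]
    rw [getElem_leftInvSeq_alternatingWord _ _ _ _ _ (by omega),
      getElem_leftInvSeq_alternatingWord _ _ _ _ _ (by omega),
      prod_alternatingWord_eq_mul_pow, prod_alternatingWord_eq_mul_pow]
    have h1 : (2 * (M i j + k) + 1) / 2 = M i j + k := by omega
    have h2 : (2 * k + 1) / 2 = k := by omega
    have h3 : ¬ Even (2 * (M i j + k) + 1) := by simp
    have h4 : ¬ Even (2 * k + 1) := by simp
    rw [h1, h2, if_neg h3, if_neg h4, pow_add]
    simp
  have := congrArg (count t) (take_append_drop (M i j) l)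
  rw [count_append, hper] at this
  exact ⟨_, this.symm⟩

/-- The braid relations hold for the action on `W × ℤ/2`: a relator fixes the first coordinate, and
changes the second one an even number of times. -/
theorem isLiftable_signedConj : M.IsLiftable cs.signedConj := by
  classical
  intro i j
  rw [← map_alternatingWord_prod]
  funext ⟨t, e⟩
  rw [prod_map_signedConj_apply]
  have h0 : ((count t (cs.rightInvSeq (alternatingWord i j (2 * M i j))) : ℕ) : ZMod 2) = 0 :=
    (ZMod.natCast_eq_zero_iff_even).2 (cs.even_count_rightInvSeq_alternatingWord i j t)
  have h1 : cs.wordProd (alternatingWord i j (2 * M i j)) = 1 := by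
    rw [prod_alternatingWord_eq_mul_pow]; simp
  rw [h0, h1]
  simp [Function.End.one_def]

/-- The reflection cocycle: the parity of the number of occurrences of `t` in the right inversion
sequence of an arbitrary word for `w`. -/
def inversionParity (w t : W) : ZMod 2 :=
  (cs.lift ⟨cs.signedConj, cs.isLiftable_signedConj⟩ w (t, 0)).2

theorem lift_signedConj_wordProd (ω : List B) :
    cs.lift ⟨cs.signedConj, cs.isLiftable_signedConj⟩ (cs.wordProd ω) =
      (ω.map cs.signedConj).prod := by
  rw [wordProd, map_list_prod, map_map]
  congr 2
  funext i
  exact cs.lift_apply_simple cs.isLiftable_signedConj i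

theorem lift_signedConj_apply (w t : W) (e : ZMod 2) :
    cs.lift ⟨cs.signedConj, cs.isLiftable_signedConj⟩ w (t, e) =
      (w * t * w⁻¹, e + cs.inversionParity w t) := by
  classical
  obtain ⟨ω, -, rfl⟩ := cs.exists_isReduced w
  rw [inversionParity, lift_signedConj_wordProd, prod_map_signedConj_apply,
    prod_map_signedConj_apply, zero_add]

open Classical in
theorem inversionParity_wordProd (ω : List B) (t : W) :
    cs.inversionParity (cs.wordProd ω) t = ((cs.rightInvSeq ω).count t : ZMod 2) := by
  rw [inversionParity, lift_signedConj_wordProd, prod_map_signedConj_apply, zero_add]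

theorem inversionParity_mul (v w t : W) :
    cs.inversionParity (v * w) t =
      cs.inversionParity w t + cs.inversionParity v (w * t * w⁻¹) := by
  have h := cs.lift_signedConj_apply (v * w) t 0
  rw [map_mul, Function.End.mul_apply', lift_signedConj_apply,
    lift_signedConj_apply] at h
  simpa using (congrArg Prod.snd h).symm

open Classical in
theorem inversionParity_simple (i : B) (t : W) :
    cs.inversionParity (cs.simple i) t = if t = cs.simple i then 1 else 0 := by
  rw [← wordProd_singleton, inversionParity_wordProd, rightInvSeq_singleton, count_singleton]
  by_cases h : t = cs.simple i
  · simp [h]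
  · simp [h, Ne.symm h]

theorem IsReflection.inversionParity_self {t : W} (ht : cs.IsReflection t) :
    cs.inversionParity t t = 1 := by
  obtain ⟨w, i, rfl⟩ := ht
  have h1 : cs.inversionParity w (w⁻¹ * (w * cs.simple i * w⁻¹) * w⁻¹⁻¹) +
      cs.inversionParity w⁻¹ (w * cs.simple i * w⁻¹) = 0 := by
    have := cs.inversionParity_mul w w⁻¹ (w * cs.simple i * w⁻¹)
    rw [mul_inv_cancel, ← cs.wordProd_nil, inversionParity_wordProd] at this
    rw [add_comm, ← this]
    simp
  have h2 : w⁻¹ * (w * cs.simple i * w⁻¹) * w⁻¹⁻¹ = cs.simple i := by group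
  rw [h2] at h1
  rw [inversionParity_mul, inversionParity_mul, h2, inversionParity_simple, if_pos rfl]
  rw [show cs.simple i * cs.simple i * (cs.simple i)⁻¹ = cs.simple i by simp]
  linear_combination h1

theorem IsReduced.mem_rightInvSeq_iff_inversionParity {ω : List B} (hω : cs.IsReduced ω) (t : W) :
    t ∈ cs.rightInvSeq ω ↔ cs.inversionParity (cs.wordProd ω) t = 1 := by
  classical
  rw [inversionParity_wordProd]
  constructor
  · intro h
    rw [count_eq_one_of_mem hω.nodup_rightInvSeq h, Nat.cast_one]
  · intro h
    by_contra h'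
    rw [count_eq_zero_of_not_mem h'] at h
    simp at h

theorem isRightInversion_of_inversionParity {w t : W} (h : cs.inversionParity w t = 1) :
    cs.IsRightInversion w t := by
  obtain ⟨ω, hω, rfl⟩ := cs.exists_isReduced w
  exact cs.isRightInversion_of_mem_rightInvSeq hω
    ((hω.mem_rightInvSeq_iff_inversionParity cs t).2 h)

/-- Strong exchange property: a reflection shortens `w` if and only if it occurs in the inversion
sequences of `w`. -/
theorem IsReflection.isRightInversion_iff {t : W} (ht : cs.IsReflection t) (w : W) :
    cs.IsRightInversion w t ↔ cs.inversionParity w t = 1 := by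
  refine ⟨fun h => ?_, cs.isRightInversion_of_inversionParity⟩
  by_contra hne
  have h0 : cs.inversionParity w t = 0 := by
    generalize cs.inversionParity w t = a at hne
    revert hne; revert a; decide
  -- The cocycle identity makes `t` an inversion of `w * t`, and it cannot be one of `w` as well.
  refine (ht.isRightInversion_mul_left_iff.1 (cs.isRightInversion_of_inversionParity ?_)) h
  rw [inversionParity_mul, ht.inversionParity_self, mul_inv_cancel_right, h0, add_zero]

/-- Left multiplication by `s` changes the membership of `t` in the right descent set of `w` only if
`s w = w t`. -/
theorem isRightDescent_simple_mul_iff {i j : B} {w : W}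
    (h : cs.simple i * w ≠ w * cs.simple j) :
    cs.IsRightDescent (cs.simple i * w) j ↔ cs.IsRightDescent w j := by
  have hr := cs.isReflection_simple j
  rw [← isRightInversion_simple_iff_isRightDescent, ← isRightInversion_simple_iff_isRightDescent,
    hr.isRightInversion_iff, hr.isRightInversion_iff, inversionParity_mul, inversionParity_simple,
    if_neg, add_zero]
  intro h'
  exact h (by rw [← h']; group)

theorem isLeftDescent_mul_simple_iff {i j : B} {w : W}
    (h : cs.simple i * w ≠ w * cs.simple j) :
    cs.IsLeftDescent (w * cs.simple j) i ↔ cs.IsLeftDescent w i := by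
  rw [← isRightDescent_inv_iff, ← isRightDescent_inv_iff, mul_inv_rev, inv_simple]
  refine cs.isRightDescent_simple_mul_iff fun h' => h ?_
  simpa using (congrArg (·⁻¹) h').symm

end CoxeterSystem

end

noncomputable section

namespace CoxeterHecke

/-! ### Monomials of reduced expressions -/

section Monomials

variable {B W : Type*} [Group W] {M : CoxeterMatrix B} (cs : CoxeterSystem M W)

/-- A class-invariant family extends to a class function on `W`. -/
theorem IsClassInvariant.exists_class_function {c : B → ℂ} (hc : IsClassInvariant cs c) :
    ∃ C : W → ℂ, (∀ i, C (cs.simple i) = c i) ∧ ∀ u t, C (u * t * u⁻¹) = C t := by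
  classical
  refine ⟨fun t => if h : ∃ i, IsConj (cs.simple i) t then c h.choose else 1, fun i => ?_,
    fun u t => ?_⟩
  · have h : ∃ j, IsConj (cs.simple j) (cs.simple i) := ⟨i, IsConj.refl _⟩
    simp only [dif_pos h]
    exact hc _ _ h.choose_spec
  · have hconj : IsConj t (u * t * u⁻¹) := isConj_iff.2 ⟨u, rfl⟩
    by_cases h : ∃ i, IsConj (cs.simple i) t
    · have h' : ∃ i, IsConj (cs.simple i) (u * t * u⁻¹) :=
        ⟨h.choose, h.choose_spec.trans hconj⟩
      simp only [dif_pos h, dif_pos h']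
      exact hc _ _ (h'.choose_spec.trans (h.choose_spec.trans hconj).symm)
    · have h' : ¬ ∃ i, IsConj (cs.simple i) (u * t * u⁻¹) :=
        fun ⟨i, hi⟩ => h ⟨i, hi.trans hconj.symm⟩
      simp only [dif_neg h, dif_neg h']

/-- For class-invariant `c`, the monomial of `w` may be computed from any reduced expression:
it is the product over the inversion set of `w` of the class function extending `c`. -/
theorem monomial_wordProd {c : B → ℂ} (hc : IsClassInvariant cs c) {ω : List B}
    (hω : cs.IsReduced ω) : monomial cs c (cs.wordProd ω) = (ω.map c).prod := by
  obtain ⟨C, hC, hconj⟩ := hc.exists_class_function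
  have key (ω : List B) : (ω.map c).prod = ((cs.rightInvSeq ω).map C).prod := by
    induction ω with
    | nil => simp
    | cons i ω ih =>
      have := hconj (cs.wordProd ω)⁻¹ (cs.simple i)
      rw [inv_inv] at this
      simp [CoxeterSystem.rightInvSeq, ih, this, hC]
  have hr := isReduced_reducedWord cs (cs.wordProd ω)
  rw [monomial, key, key]
  refine List.Perm.prod_eq (List.Perm.map _ ?_)
  rw [List.perm_ext_iff_of_nodup hr.nodup_rightInvSeq hω.nodup_rightInvSeq]
  intro t
  rw [hr.mem_rightInvSeq_iff_inversionParity, hω.mem_rightInvSeq_iff_inversionParity,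
    wordProd_reducedWord]

theorem monomial_one (c : B → ℂ) : monomial cs c 1 = 1 := by
  have h := (isReduced_reducedWord cs 1).symm
  rw [wordProd_reducedWord, cs.length_one, List.length_eq_zero_iff] at h
  simp [monomial, h]

theorem monomial_simple_mul {c : B → ℂ} (hc : IsClassInvariant cs c) {w : W} {i : B}
    (h : ¬ cs.IsLeftDescent w i) : monomial cs c (cs.simple i * w) = c i * monomial cs c w := by
  obtain ⟨ω, hω, rfl⟩ := cs.exists_isReduced w
  have hr : cs.IsReduced (i :: ω) := by
    rw [CoxeterSystem.IsReduced, cs.wordProd_cons, (cs.not_isLeftDescent_iff).1 h, hω.eq,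
      List.length_cons]
  rw [← cs.wordProd_cons, monomial_wordProd cs hc hr, monomial_wordProd cs hc hω, List.map_cons,
    List.prod_cons]

theorem norm_monomial_sq (c z : B → ℂ) (h : ∀ i, ‖c i‖ ^ 2 = ‖z i‖) (w : W) :
    ‖monomial cs c w‖ ^ 2 = ‖monomial cs z w‖ := by
  rw [monomial, monomial]
  induction reducedWord cs w with
  | nil => simp
  | cons i ω ih => simp [mul_pow, h, ih]

end Monomials

/-! ### Left and right Hecke operators -/

section SelfAdjoint

variable {X : Type*}

theorem isSelfAdjoint_compOp (e : X ≃ X) (he : ∀ x, e (e x) = x) : IsSelfAdjoint (compOp e) := by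
  rw [ContinuousLinearMap.isSelfAdjoint_iff_isSymmetric]
  intro f g
  change inner ℂ (compOp e f) g = inner ℂ f (compOp e g)
  rw [lp.inner_eq_tsum, lp.inner_eq_tsum, ← e.tsum_eq]
  simp [he]

theorem isSelfAdjoint_restrictOp (A : Set X) : IsSelfAdjoint (restrictOp A) := by
  rw [ContinuousLinearMap.isSelfAdjoint_iff_isSymmetric]
  intro f g
  change inner ℂ (restrictOp A f) g = inner ℂ f (restrictOp A g)
  rw [lp.inner_eq_tsum, lp.inner_eq_tsum]
  refine tsum_congr fun x => ?_
  by_cases hx : x ∈ A <;> simp [hx]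

end SelfAdjoint

section HeckeOperators

variable {B W : Type*} [Group W] {M : CoxeterMatrix B} (cs : CoxeterSystem M W) (q : B → ℝ)

/-- The right-handed Hecke operator: the sum of the right translation by `s` and of `p_s(q)` times
the projection onto the functions supported on `{w | |w s| < |w|}`. -/
def rightHeckeOp (i : B) : ell2 W →L[ℂ] ell2 W :=
  compOp (Equiv.mulRight (cs.simple i)) +
    (pCoeff q i : ℂ) • restrictOp {w : W | cs.IsRightDescent w i}

open Classical in
theorem heckeOp_apply (i : B) (f : ell2 W) (w : W) :
    heckeOp cs q i f w =
      f (cs.simple i * w) + if cs.IsLeftDescent w i then pCoeff q i * f w else 0 := by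
  change f (cs.simple i * w) + (pCoeff q i : ℂ) * _ = _
  by_cases h : cs.IsLeftDescent w i <;> simp [h]

open Classical in
theorem rightHeckeOp_apply (i : B) (f : ell2 W) (w : W) :
    rightHeckeOp cs q i f w =
      f (w * cs.simple i) + if cs.IsRightDescent w i then pCoeff q i * f w else 0 := by
  change f (w * cs.simple i) + (pCoeff q i : ℂ) * _ = _
  by_cases h : cs.IsRightDescent w i <;> simp [h]

theorem isSelfAdjoint_ofReal_smul {E : Type*} [AddCommGroup E] [Module ℂ E] [StarAddMonoid E]
    [StarModule ℂ E] {x : E} (hx : IsSelfAdjoint x) (r : ℝ) : IsSelfAdjoint ((r : ℂ) • x) :=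
  IsSelfAdjoint.smul (Complex.conj_ofReal r) hx

theorem isSelfAdjoint_heckeOp (i : B) : IsSelfAdjoint (heckeOp cs q i) :=
  (isSelfAdjoint_compOp _ fun w => by simp).add
    (isSelfAdjoint_ofReal_smul (isSelfAdjoint_restrictOp _) _)

theorem isSelfAdjoint_rightHeckeOp (i : B) : IsSelfAdjoint (rightHeckeOp cs q i) :=
  (isSelfAdjoint_compOp _ fun w => by simp).add
    (isSelfAdjoint_ofReal_smul (isSelfAdjoint_restrictOp _) _)

variable {q}

/-- Left and right Hecke operators commute. The exceptional case `s w = w t`, in which the descent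
sets change, uses that `s` and `t` are then conjugate, so that their parameters agree. -/
theorem commute_heckeOp_rightHeckeOp (hq : IsClassInvariant cs q) (i j : B) :
    Commute (heckeOp cs q i) (rightHeckeOp cs q j) := by
  classical
  refine ContinuousLinearMap.ext fun f => lp.ext (funext fun w => ?_)
  change heckeOp cs q i (rightHeckeOp cs q j f) w = rightHeckeOp cs q j (heckeOp cs q i f) w
  simp only [heckeOp_apply, rightHeckeOp_apply]
  by_cases h : cs.simple i * w = w * cs.simple j
  · have hp : pCoeff q i = pCoeff q j := by
      have : q i = q j := hq i j (IsConj.symm (isConj_iff.2 ⟨w, by rw [← h]; group⟩))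
      rw [pCoeff, pCoeff, this]
    have h1 : cs.IsLeftDescent w i ↔ cs.IsRightDescent w j := by
      rw [CoxeterSystem.IsLeftDescent, CoxeterSystem.IsRightDescent, h]
    have h2 : cs.IsRightDescent (w * cs.simple j) j ↔ ¬ cs.IsRightDescent w j := by
      rw [cs.isRightDescent_iff_not_isRightDescent_mul, mul_assoc, cs.simple_mul_simple_self,
        mul_one]
    have h3 : cs.IsLeftDescent (w * cs.simple j) i ↔ ¬ cs.IsRightDescent w j := by
      rw [← h, cs.isLeftDescent_iff_not_isLeftDescent_mul, ← mul_assoc, cs.simple_mul_simple_self,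
        one_mul, h1]
    have h4 : cs.simple i * (w * cs.simple j) = w := by rw [← h]; simp
    simp only [h1, h2, h3, h4, hp, mul_assoc, h]
    by_cases hd : cs.IsRightDescent w j <;> simp [hd]
  · simp only [cs.isRightDescent_simple_mul_iff h, cs.isLeftDescent_mul_simple_iff h, mul_assoc]
    by_cases hd : cs.IsRightDescent w j <;> by_cases hd' : cs.IsLeftDescent w i <;>
      simp only [hd, hd', if_true, if_false] <;> ring

open Classical in
theorem rightHeckeOp_single {i : B} {w : W} (h : ¬ cs.IsRightDescent w i) :
    rightHeckeOp cs q i (lp.single 2 w 1) = lp.single 2 (w * cs.simple i) 1 := by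
  refine lp.ext (funext fun v => ?_)
  rw [rightHeckeOp_apply]
  have h1 : v * cs.simple i = w ↔ v = w * cs.simple i := by
    constructor <;> rintro rfl <;> simp
  by_cases hv : v = w
  · subst hv
    simp [h, lp.single_apply, Pi.single_apply]
  · simp [lp.single_apply, Pi.single_apply, h1, hv]

theorem rightHeckeOp_rightHeckeOp (i : B) (f : ell2 W) :
    rightHeckeOp cs q i (rightHeckeOp cs q i f) =
      f + (pCoeff q i : ℂ) • rightHeckeOp cs q i f := by
  classical
  refine lp.ext (funext fun w => ?_)
  change _ = f w + (pCoeff q i : ℂ) * rightHeckeOp cs q i f w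
  have h := cs.isRightDescent_iff_not_isRightDescent_mul (w := w) (i := i)
  by_cases hd : cs.IsRightDescent w i <;> simp [rightHeckeOp_apply, hd, h.symm, mul_assoc]

theorem pCoeff_eq (i : B) (hq : 0 < q i) :
    pCoeff q i = Real.sqrt (q i) - (Real.sqrt (q i))⁻¹ := by
  have h := Real.sqrt_pos.2 hq
  rw [pCoeff, Real.rpow_neg hq.le, ← Real.sqrt_eq_rpow]
  field_simp
  rw [Real.sq_sqrt hq.le]

/-- The Hecke relation bounds `R_s` from below: its eigenvalues are `q_s ^ (1/2)` and
`-q_s ^ (-1/2)`. -/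
theorem min_mul_norm_sq_le (i : B) (hq : 0 < q i) (f : ell2 W) :
    min (q i) (q i)⁻¹ * ‖f‖ ^ 2 ≤ ‖rightHeckeOp cs q i f‖ ^ 2 := by
  set R := rightHeckeOp cs q i with hR
  set c := Real.sqrt (q i) with hc
  have hc0 : 0 < c := Real.sqrt_pos.2 hq
  have hqc : q i = c ^ 2 := (Real.sq_sqrt hq.le).symm
  have hp : pCoeff q i = c - c⁻¹ := pCoeff_eq i hq
  have hsymm := (ContinuousLinearMap.isSelfAdjoint_iff_isSymmetric.1
    (isSelfAdjoint_rightHeckeOp cs q i))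
  have hX : ‖R f‖ ^ 2 = ‖f‖ ^ 2 + (c - c⁻¹) * RCLike.re (inner ℂ (R f) f) := by
    have h1 : inner ℂ (R f) (R f) = inner ℂ (R (R f)) f := (hsymm (R f) f).symm
    rw [← inner_self_eq_norm_sq (𝕜 := ℂ), h1, hR, rightHeckeOp_rightHeckeOp, inner_add_left,
      inner_smul_left, map_add, inner_self_eq_norm_sq (𝕜 := ℂ), ← hR, hp]
    simp
  -- The two components of `f` in the eigenspaces of `R`, up to a factor.
  have ha : 0 ≤ ‖R f + ((c⁻¹ : ℝ) : ℂ) • f‖ ^ 2 := sq_nonneg _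
  have hb : 0 ≤ ‖R f - ((c : ℝ) : ℂ) • f‖ ^ 2 := sq_nonneg _
  rw [norm_add_sq (𝕜 := ℂ), inner_smul_right, norm_smul] at ha
  rw [norm_sub_sq (𝕜 := ℂ), inner_smul_right, norm_smul] at hb
  simp only [RCLike.re_to_complex, Complex.re_ofReal_mul, Complex.norm_real, Real.norm_eq_abs,
    mul_pow, sq_abs] at ha hb hX
  rw [hqc]
  generalize ‖R f‖ ^ 2 = x at *
  generalize ‖f‖ ^ 2 = y at *
  generalize (inner ℂ (R f) f).re = z at *
  have hci : c * c⁻¹ = 1 := mul_inv_cancel₀ hc0.ne'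
  have hci0 : 0 < c⁻¹ := inv_pos.2 hc0
  rw [← inv_pow]
  generalize c⁻¹ = d at *
  have hcd : 0 < c + d := by positivity
  rcases lt_trichotomy c d with h | rfl | h
  · have h1 : (d - c) * (x - 2 * (c * z) + c ^ 2 * y) = (c + d) * (x - c ^ 2 * y) := by
      rw [hX]; linear_combination 2 * c * y * hci
    have h2 : 0 ≤ (c + d) * (x - c ^ 2 * y) := h1 ▸ mul_nonneg (sub_nonneg.2 h.le) hb
    rw [min_eq_left (pow_le_pow_left₀ hc0.le h.le 2)]
    exact sub_nonneg.1 (nonneg_of_mul_nonneg_right h2 hcd)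
  · rw [min_self, hX, pow_two, hci]
    simp
  · have h1 : (c - d) * (x + 2 * (d * z) + d ^ 2 * y) = (c + d) * (x - d ^ 2 * y) := by
      rw [hX]; linear_combination 2 * d * y * hci
    have h2 : 0 ≤ (c + d) * (x - d ^ 2 * y) := h1 ▸ mul_nonneg (sub_nonneg.2 h.le) ha
    rw [min_eq_right (pow_le_pow_left₀ hci0.le h.le 2)]
    exact sub_nonneg.1 (nonneg_of_mul_nonneg_right h2 hcd)

end HeckeOperators

end CoxeterHecke

end

noncomputable section

namespace CoxeterHecke

/-! ### Joint eigenvectors and rank one operators -/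

section RankOne

variable {B W : Type*} [Group W] {M : CoxeterMatrix B} (cs : CoxeterSystem M W) {q : B → ℝ}

theorem heckeOp_mem_heckeCStarAlgebra (q : B → ℝ) (i : B) :
    heckeOp cs q i ∈ heckeCStarAlgebra cs q :=
  StarSubalgebra.le_topologicalClosure _ (StarAlgebra.subset_adjoin ℂ _ ⟨i, rfl⟩)

/-- The right Hecke operators lie in the commutant of the Hecke algebra. -/
theorem rightHeckeOp_mem_centralizer (hq : IsClassInvariant cs q) (j : B) :
    rightHeckeOp cs q j ∈ Set.centralizer
      (heckeCStarAlgebra cs q : Set (ell2 W →L[ℂ] ell2 W)) := by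
  have hle : heckeCStarAlgebra cs q ≤ StarSubalgebra.centralizer ℂ {rightHeckeOp cs q j} := by
    refine StarSubalgebra.topologicalClosure_minimal (StarAlgebra.adjoin_le ?_)
      (Set.isClosed_centralizer _)
    rintro _ ⟨i, rfl⟩
    rw [SetLike.mem_coe, StarSubalgebra.mem_centralizer_iff]
    rintro _ rfl
    rw [(isSelfAdjoint_rightHeckeOp cs q j).star_eq]
    have h := (commute_heckeOp_rightHeckeOp cs hq i j).symm
    exact ⟨h, h⟩
  intro x hx
  exact ((StarSubalgebra.mem_centralizer_iff ℂ).1 (hle hx) _ rfl).1.symm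

/-- A joint eigenvector of the Hecke operators is determined by its value at `1`. -/
theorem eq_smul_of_heckeOp_eigen {c : B → ℂ} {ξ η : ell2 W} (hξ1 : ξ 1 = 1)
    (hξ : ∀ i, heckeOp cs q i ξ = c i • ξ) (hη : ∀ i, heckeOp cs q i η = c i • η) :
    η = η 1 • ξ := by
  classical
  have step (f : ell2 W) (hf : ∀ i, heckeOp cs q i f = c i • f) (w : W) (i : B) :
      f (cs.simple i * w) =
        (c i - if cs.IsLeftDescent w i then (pCoeff q i : ℂ) else 0) * f w := by
    have h : heckeOp cs q i f w = c i * f w := by rw [hf i]; rfl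
    rw [heckeOp_apply] at h
    by_cases hd : cs.IsLeftDescent w i <;> simp only [hd, if_true, if_false] at h ⊢ <;>
      linear_combination h
  refine lp.ext (funext fun w => ?_)
  change η w = η 1 * ξ w
  induction w using cs.simple_induction_left with
  | one => rw [hξ1, mul_one]
  | mul_simple_left w i ih => rw [step η hη, step ξ hξ, ih]; ring

/-- An element `y` of the commutant and its adjoint both act on the joint eigenvector `ξ` by
scalars, so `y` commutes with the rank one operator of `ξ`. -/
theorem rankOne_mem_heckeVonNeumannAlgebra {c : B → ℂ} {ξ : ell2 W} (hξ1 : ξ 1 = 1)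
    (hξ : ∀ i, heckeOp cs q i ξ = c i • ξ) :
    InnerProductSpace.rankOne ℂ ξ ξ ∈ heckeVonNeumannAlgebra cs q := by
  rw [← SetLike.mem_coe, coe_heckeVonNeumannAlgebra]
  intro y hy
  have hcomm (i : B) : heckeOp cs q i * y = y * heckeOp cs q i :=
    hy _ (heckeOp_mem_heckeCStarAlgebra cs q i)
  have hcomm' (i : B) : heckeOp cs q i * star y = star y * heckeOp cs q i := by
    have := congrArg star (hcomm i)
    rwa [star_mul, star_mul, (isSelfAdjoint_heckeOp cs q i).star_eq, eq_comm] at this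
  have hscal (z : ell2 W →L[ℂ] ell2 W) (hz : ∀ i, heckeOp cs q i * z = z * heckeOp cs q i) :
      z ξ = z ξ 1 • ξ := by
    refine eq_smul_of_heckeOp_eigen cs hξ1 hξ fun i => ?_
    have h : heckeOp cs q i (z ξ) = z (heckeOp cs q i ξ) := DFunLike.congr_fun (hz i) ξ
    rw [h, hξ, map_smul]
  have h1 := hscal y hcomm
  have h2 := hscal (star y) hcomm'
  generalize y ξ 1 = α at h1
  generalize (star y) ξ 1 = β at h2
  have hne : inner ℂ ξ ξ ≠ 0 := by
    rw [inner_self_ne_zero]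
    rintro rfl
    simp at hξ1
  have hadj (v : ell2 W) : inner ℂ ξ (y v) = inner ℂ (star y ξ) v :=
    (ContinuousLinearMap.adjoint_inner_left y v ξ).symm
  have hαβ : α = starRingEnd ℂ β := by
    have := hadj ξ
    rw [h1, h2, inner_smul_left, inner_smul_right] at this
    exact mul_right_cancel₀ hne this
  refine ContinuousLinearMap.ext fun v => ?_
  change y (InnerProductSpace.rankOne ℂ ξ ξ v) = InnerProductSpace.rankOne ℂ ξ ξ (y v)
  rw [InnerProductSpace.rankOne_apply, InnerProductSpace.rankOne_apply, map_smul, h1, hadj, h2,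
    inner_smul_left, hαβ, smul_smul, mul_comm]

/-- If the `c_s` are roots of the Hecke relation, `w ↦ c_w` is a joint eigenvector of the Hecke
operators, provided that it is square-summable. -/
theorem exists_heckeOp_eigenvector {c : B → ℂ} (hc : IsClassInvariant cs c)
    (hpc : ∀ i, c i ^ 2 = 1 + pCoeff q i * c i)
    (hsum : Summable fun w => ‖monomial cs c w‖ ^ 2) :
    ∃ ξ : ell2 W, ξ 1 = 1 ∧ ∀ i, heckeOp cs q i ξ = c i • ξ := by
  classical
  refine ⟨⟨monomial cs c, memℓp_gen (by simpa using hsum)⟩, monomial_one cs c, fun i => ?_⟩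
  refine lp.ext (funext fun w => ?_)
  rw [heckeOp_apply]
  change monomial cs c (cs.simple i * w) +
    (if cs.IsLeftDescent w i then (pCoeff q i : ℂ) * monomial cs c w else 0) =
    c i * monomial cs c w
  by_cases hd : cs.IsLeftDescent w i
  · have h := monomial_simple_mul cs hc (cs.isLeftDescent_iff_not_isLeftDescent_mul.1 hd)
    rw [cs.simple_mul_simple_cancel_left] at h
    rw [if_pos hd, h]
    linear_combination (-monomial cs c (cs.simple i * w)) * hpc i
  · rw [if_neg hd, add_zero, monomial_simple_mul cs hc hd]

/-- Both `√r_s = q_s ^ (1/2)` for `ε_s = 1` and `-√r_s = -q_s ^ (-1/2)` for `ε_s = -1` are roots of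
the quadratic Hecke relation. -/
theorem signed_sqrt_sq_eq {q r : B → ℝ} {ε : B → ℤˣ} (hr : ∀ i, 0 < r i)
    (hqr : q = fun i => r i ^ ((ε i : ℤˣ) : ℤ)) (i : B) :
    ((((ε i : ℤ) : ℝ) * Real.sqrt (r i) : ℝ) : ℂ) ^ 2 =
      1 + pCoeff q i * (((ε i : ℤ) : ℝ) * Real.sqrt (r i) : ℝ) := by
  have hs := Real.sqrt_pos.2 (hr i)
  have hq : 0 < q i := by rw [hqr]; exact zpow_pos (hr i) _
  rw [pCoeff_eq i hq, hqr]
  norm_cast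
  rcases Int.units_eq_one_or (ε i) with h | h <;> simp [h] <;> field_simp <;> ring

theorem exists_compact_of_mem_convergenceRegion' (hq : q ∈ convergenceRegion' cs) :
    ∃ x ∈ heckeVonNeumannAlgebra cs q, IsCompactOperator x ∧ x ≠ 0 := by
  obtain ⟨r, ⟨hr0, hrc⟩, ⟨-, hsum⟩, ε, hε, hqr⟩ := hq
  set c : B → ℂ := fun i => (((ε i : ℤ) : ℝ) * Real.sqrt (r i) : ℝ) with hc
  have hnorm (i : B) : ‖c i‖ ^ 2 = ‖(r i : ℂ)‖ := by
    rw [hc, Complex.norm_real, Complex.norm_real, Real.norm_eq_abs, Real.norm_eq_abs, sq_abs,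
      mul_pow, Real.sq_sqrt (hr0 i).le, abs_of_pos (hr0 i)]
    rcases Int.units_eq_one_or (ε i) with h | h <;> simp [h]
  have hcc : IsClassInvariant cs c := fun i j hij => by simp only [hc, hrc i j hij, hε i j hij]
  obtain ⟨ξ, hξ1, hξ⟩ := exists_heckeOp_eigenvector (q := q) cs hcc (signed_sqrt_sq_eq hr0 hqr)
    (by simpa only [norm_monomial_sq cs c _ hnorm] using hsum.norm)
  refine ⟨_, rankOne_mem_heckeVonNeumannAlgebra cs hξ1 hξ, ?_, ?_⟩
  · rw [InnerProductSpace.rankOne_def']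
    exact (isCompactOperator_of_locallyCompactSpace_rng
      (ContinuousLinearMap.toSpanSingleton ℂ ξ)).comp_clm _
  · intro h
    have h2 := DFunLike.congr_fun h ξ
    have hξ0 : ξ ≠ 0 := by
      rintro rfl
      simp at hξ1
    simp [InnerProductSpace.rankOne_apply, hξ0] at h2

end RankOne

/-! ### Finite-dimensional invariant subspaces and convergence -/

section Convergence

/-- Over a finite-dimensional subspace the squared norms of the projected basis vectors of
`ℓ²` are summable; their sum is the trace of the projection. -/
theorem summable_norm_starProjection_single_sq {X : Type*} [DecidableEq X]
    (V : Submodule ℂ (ell2 X)) [FiniteDimensional ℂ V] :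
    Summable fun x => ‖V.starProjection (lp.single 2 x (1 : ℂ))‖ ^ 2 := by
  let b := stdOrthonormalBasis ℂ V
  have h (x : X) : ‖V.starProjection (lp.single 2 x (1 : ℂ))‖ ^ 2 =
      ∑ k, ‖(b k : ell2 X) x‖ ^ 2 := by
    change ‖V.orthogonalProjectionOnto (lp.single 2 x (1 : ℂ))‖ ^ 2 = _
    rw [← b.sum_sq_norm_inner_right]
    refine Finset.sum_congr rfl fun k _ => ?_
    rw [Submodule.inner_orthogonalProjectionOnto_eq_of_mem_left, lp.inner_single_right]
    simp
  simp only [h]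
  exact summable_sum fun k _ => by
    simpa using (lp.memℓp (b k : ell2 X)).summable (by norm_num)

variable {E : Type*} [NormedAddCommGroup E] [InnerProductSpace ℂ E]

theorem starProjection_comm_of_isSymmetric (V : Submodule ℂ E) [V.HasOrthogonalProjection]
    {R : E →L[ℂ] E} (hR : (R : E →ₗ[ℂ] E).IsSymmetric) (hV : ∀ v ∈ V, R v ∈ V) (v : E) :
    V.starProjection (R v) = R (V.starProjection v) := by
  refine Submodule.eq_starProjection_of_mem_of_inner_eq_zero
    (hV _ (V.starProjection_apply_mem v)) fun u hu => ?_
  have h : inner ℂ (R (v - V.starProjection v)) u = inner ℂ (v - V.starProjection v) (R u) :=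
    hR _ _
  rw [← map_sub, h]
  exact V.starProjection_inner_eq_zero v _ (hV u hu)

variable {B W : Type*} [Group W] {M : CoxeterMatrix B} (cs : CoxeterSystem M W) {q : B → ℝ}

theorem isReduced_concat_iff {ω : List B} {i : B} :
    cs.IsReduced (ω ++ [i]) ↔ cs.IsReduced ω ∧ ¬ cs.IsRightDescent (cs.wordProd ω) i := by
  have hlen : cs.length (cs.wordProd (ω ++ [i])) = cs.length (cs.wordProd ω * cs.simple i) := by
    rw [cs.wordProd_append, cs.wordProd_singleton]
  rw [cs.not_isRightDescent_iff]
  constructor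
  · intro h
    have h1 : cs.IsReduced ω := by simpa using h.take ω.length
    refine ⟨h1, ?_⟩
    rw [← hlen, h.eq, h1.eq, List.length_append, List.length_singleton]
  · rintro ⟨h1, h2⟩
    rw [CoxeterSystem.IsReduced, hlen, h2, h1.eq, List.length_append, List.length_singleton]

open Classical in
theorem prod_min_mul_norm_sq_le (hq : ∀ i, 0 < q i) {P : ell2 W →L[ℂ] ell2 W}
    (hP : ∀ i v, P (rightHeckeOp cs q i v) = rightHeckeOp cs q i (P v)) {ω : List B}
    (hω : cs.IsReduced ω) :
    (ω.map fun i => min (q i) (q i)⁻¹).prod * ‖P (lp.single 2 1 (1 : ℂ))‖ ^ 2 ≤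
      ‖P (lp.single 2 (cs.wordProd ω) (1 : ℂ))‖ ^ 2 := by
  induction ω using List.reverseRecOn with
  | nil => simp
  | append_singleton ω i ih =>
    rw [isReduced_concat_iff] at hω
    rw [cs.wordProd_append, cs.wordProd_singleton, ← rightHeckeOp_single (q := q) cs hω.2, hP]
    refine le_trans ?_ (min_mul_norm_sq_le cs i (hq i) _)
    have h0 : 0 ≤ min (q i) (q i)⁻¹ := le_min (hq i).le (inv_pos.2 (hq i)).le
    calc _ = min (q i) (q i)⁻¹ * ((ω.map fun i => min (q i) (q i)⁻¹).prod *
          ‖P (lp.single 2 1 (1 : ℂ))‖ ^ 2) := by simp; ring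
      _ ≤ _ := mul_le_mul_of_nonneg_left (ih hω.1) h0

open Classical in
theorem apply_single_eq_zero {P : ell2 W →L[ℂ] ell2 W}
    (hP : ∀ i v, P (rightHeckeOp cs q i v) = rightHeckeOp cs q i (P v))
    (h1 : P (lp.single 2 1 (1 : ℂ)) = 0) (w : W) : P (lp.single 2 w (1 : ℂ)) = 0 := by
  obtain ⟨ω, hω, rfl⟩ := cs.exists_isReduced w
  induction ω using List.reverseRecOn with
  | nil => simpa using h1
  | append_singleton ω i ih =>
    rw [isReduced_concat_iff] at hω
    rw [cs.wordProd_append, cs.wordProd_singleton, ← rightHeckeOp_single (q := q) cs hω.2, hP,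
      ih hω.1, map_zero]

/-- A nonzero finite-dimensional subspace invariant under the right Hecke operators forces the
growth series to converge at `min (q_s, q_s⁻¹)`. -/
theorem summable_monomial_min (hq : ∀ i, 0 < q i) (V : Submodule ℂ (ell2 W))
    [FiniteDimensional ℂ V] (hV0 : V ≠ ⊥) (hV : ∀ i, ∀ v ∈ V, rightHeckeOp cs q i v ∈ V) :
    Summable fun w => monomial cs (fun i => ((min (q i) (q i)⁻¹ : ℝ) : ℂ)) w := by
  classical
  have hP (i : B) (v : ell2 W) : V.starProjection (rightHeckeOp cs q i v) =
      rightHeckeOp cs q i (V.starProjection v) :=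
    starProjection_comm_of_isSymmetric V (ContinuousLinearMap.isSelfAdjoint_iff_isSymmetric.1
      (isSelfAdjoint_rightHeckeOp cs q i)) (hV i) v
  have h1 : V.starProjection (lp.single 2 (1 : W) (1 : ℂ)) ≠ 0 := by
    intro h1
    refine hV0 ((Submodule.eq_bot_iff _).2 fun v hv => lp.ext (funext fun w => ?_))
    have h := lp.inner_single_left (𝕜 := ℂ) w (1 : ℂ) v
    rw [← (Submodule.starProjection_eq_self_iff).2 hv,
      ← Submodule.inner_starProjection_left_eq_right,
      apply_single_eq_zero cs hP h1, inner_zero_left] at h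
    rw [(Submodule.starProjection_eq_self_iff).2 hv] at h
    simpa using h.symm
  have hpos : 0 < ‖V.starProjection (lp.single 2 (1 : W) (1 : ℂ))‖ ^ 2 := by positivity
  have hmin (i : B) : 0 < min (q i) (q i)⁻¹ := lt_min (hq i) (inv_pos.2 (hq i))
  have hnorm (ω : List B) : ‖(ω.map fun i => ((min (q i) (q i)⁻¹ : ℝ) : ℂ)).prod‖ =
      (ω.map fun i => min (q i) (q i)⁻¹).prod := by
    induction ω with
    | nil => simp
    | cons i ω ih =>
      rw [List.map_cons, List.map_cons, List.prod_cons, List.prod_cons, norm_mul, ih,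
        Complex.norm_real, Real.norm_of_nonneg (hmin i).le]
  refine Summable.of_norm_bounded ((summable_norm_starProjection_single_sq V).div_const
    (‖V.starProjection (lp.single 2 (1 : W) (1 : ℂ))‖ ^ 2)) fun w => ?_
  rw [le_div_iff₀ hpos]
  have h := prod_min_mul_norm_sq_le cs hq hP (isReduced_reducedWord cs w)
  rw [wordProd_reducedWord, ← hnorm] at h
  exact h

theorem mem_convergenceRegion'_of_invariant (hq : q ∈ PosParam cs) (V : Submodule ℂ (ell2 W))
    [FiniteDimensional ℂ V] (hV0 : V ≠ ⊥) (hV : ∀ i, ∀ v ∈ V, rightHeckeOp cs q i v ∈ V) :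
    q ∈ convergenceRegion' cs := by
  obtain ⟨hq0, hqc⟩ := hq
  refine ⟨fun i => min (q i) (q i)⁻¹, ⟨fun i => lt_min (hq0 i) (inv_pos.2 (hq0 i)), ?_⟩,
    ⟨?_, summable_monomial_min cs hq0 V hV0 hV⟩, fun i => if q i ≤ 1 then 1 else -1, ?_, ?_⟩
  · intro i j hij
    simp only [hqc i j hij]
  · intro i j hij
    simp only [hqc i j hij]
  · intro i j hij
    simp only [hqc i j hij]
  · funext i
    by_cases h : q i ≤ 1
    · simp [h, h.trans ((one_le_inv₀ (hq0 i)).2 h)]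
    · have h' := (not_le.1 h).le
      simp [h, (inv_le_one_of_one_le₀ h').trans h']

/-- The invariant subspace is an eigenspace of `x* x` for a nonzero eigenvalue; it is invariant
under the commutant, in particular under the right Hecke operators. -/
theorem mem_convergenceRegion'_of_compact (hq : q ∈ PosParam cs) {x : ell2 W →L[ℂ] ell2 W}
    (hx : x ∈ heckeVonNeumannAlgebra cs q) (hxc : IsCompactOperator x) (hx0 : x ≠ 0) :
    q ∈ convergenceRegion' cs := by
  have ha : star x * x ∈ heckeVonNeumannAlgebra cs q := mul_mem (star_mem hx) hx
  have ha0 : star x * x ≠ 0 := fun h => hx0 (CStarRing.star_mul_self_eq_zero_iff x |>.1 h)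
  have hac : IsCompactOperator (star x * x) := hxc.clm_comp (star x)
  have has := ContinuousLinearMap.isSelfAdjoint_iff_isSymmetric.1 (IsSelfAdjoint.star_mul_self x)
  generalize star x * x = a at ha ha0 hac has
  -- A nonzero compact self-adjoint operator has a nonzero eigenvalue.
  obtain ⟨μ, hμ, hμ0⟩ : ∃ μ, Module.End.HasEigenvalue (a : Module.End ℂ (ell2 W)) μ ∧ μ ≠ 0 := by
    by_contra! h
    exact ha0 ((ContinuousLinearMap.eq_zero_of_forall_hasEigenvalue_eq_zero hac has).1 h)
  have := ContinuousLinearMap.finite_dimensional_eigenspace hac μ hμ0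
  refine mem_convergenceRegion'_of_invariant cs hq
    (Module.End.eigenspace (a : Module.End ℂ (ell2 W)) μ) hμ fun i v hv => ?_
  rw [← SetLike.mem_coe, coe_heckeVonNeumannAlgebra] at ha
  have hcomm : rightHeckeOp cs q i * a = a * rightHeckeOp cs q i :=
    ha _ (rightHeckeOp_mem_centralizer cs hq.2 i)
  have h : a (rightHeckeOp cs q i v) = rightHeckeOp cs q i (a v) :=
    (DFunLike.congr_fun hcomm v).symm
  rw [Module.End.mem_eigenspace_iff] at hv ⊢
  change a v = μ • v at hv
  change a (rightHeckeOp cs q i v) = _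
  rw [h, hv, map_smul]

end Convergence

end CoxeterHecke

end

theorem theorem5 {B W : Type*} [Finite B] [Group W] [Infinite W] {M : CoxeterMatrix B}
    (cs : CoxeterSystem M W) (q : B → ℝ) (hq : q ∈ CoxeterHecke.PosParam cs) :
    (CoxeterHecke.heckeVonNeumannAlgebra cs q :
        Set (CoxeterHecke.ell2 W →L[ℂ] CoxeterHecke.ell2 W)) ∩
      {x | IsCompactOperator x} ≠ {0} ↔
    q ∈ CoxeterHecke.convergenceRegion' cs := by
  have h0 : (0 : CoxeterHecke.ell2 W →L[ℂ] CoxeterHecke.ell2 W) ∈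
      (CoxeterHecke.heckeVonNeumannAlgebra cs q :
        Set (CoxeterHecke.ell2 W →L[ℂ] CoxeterHecke.ell2 W)) ∩ {x | IsCompactOperator x} :=
    ⟨zero_mem (CoxeterHecke.heckeVonNeumannAlgebra cs q), isCompactOperator_zero⟩
  constructor
  · intro h
    obtain ⟨x, ⟨hx, hxc⟩, hx0⟩ : ∃ x ∈ (CoxeterHecke.heckeVonNeumannAlgebra cs q :
        Set (CoxeterHecke.ell2 W →L[ℂ] CoxeterHecke.ell2 W)) ∩ {x | IsCompactOperator x},
        x ≠ 0 := by
      by_contra! hall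
      exact h (Set.eq_singleton_iff_unique_mem.2 ⟨h0, hall⟩)
    exact CoxeterHecke.mem_convergenceRegion'_of_compact cs hq hx hxc hx0
  · intro h heq
    obtain ⟨x, hx, hxc, hx0⟩ := CoxeterHecke.exists_compact_of_mem_convergenceRegion' cs h
    exact hx0 (heq.subset ⟨hx, hxc⟩)
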